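/- Let $k$ be an infinite field and $S=k[x,y,z]$. For a finite set $\mathcal{A}$ of points in $\mathbf{P}^2$ over $k$ (one-dimensional subspaces of $k^3$), let $I_{\mathcal{A}}\subseteq S$ be the intersection, over the points $p\in\mathcal{A}$, of the ideals of the corresponding lines through the origin in $k^3$, i.e. the ideal of all polynomials that vanish on the union of these lines. The set $\mathcal{A}$ is called generic if $\dim_k (S/I_{\mathcal{A}})_t=\min\{|\mathcal{A}|,\binom{t+2}{2}\}$ for all $t\ge 0$, and linearly general if no three distinct points of $\mathcal{A}$ are collinear. An ideal of $S$ is pl-generated if it is generated by products of linear forms. Let $\mathcal{A}$ be a set of $6$ points in $\mathbf{P}^2$ that is generic and linearly general. Then for every labelling $p_1,\dots,p_6$ of the points of $\mathcal{A}$, if $L_{i,j}$ $(i<j)$ denotes a linear form defining the line joining $p_i$ to $p_j$, the ideal $I_{\mathcal{A}}$ is generated by the four cubics \[Q_1=L_{1,2}L_{3,4}L_{5,6},\quad Q_2=L_{1,2}L_{3,5}L_{4,6},\quad Q_3=L_{1,5}L_{2,6}L_{3,4},\quad Q_4=L_{1,3}L_{2,6}L_{4,5}.\] In particular, $I_{\mathcal{A}}$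 is pl-generated. -/

import Mathlib

open scoped LinearAlgebra.Projectivization

noncomputable section

namespace PlanePoints

variable {k : Type*} [Field k]

/-- The projective plane over `k`: the lines through the origin in `k ^ 3`. -/
abbrev Plane (k : Type*) [Field k] : Type _ := ℙ k (Fin 3 → k)

/-- The polynomial ring `S = k[x, y, z]`. -/
abbrev PolyRing (k : Type*) [Field k] : Type _ := MvPolynomial (Fin 3) k

/-- The ideal of a finite set of points in the plane: the intersection, over the points `p`, of the
ideal of the polynomials that vanish on the one-dimensional subspace `p` of `k ^ 3`. -/
def pointsIdeal (A : Finset (Plane k)) : Ideal (PolyRing k) :=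
  ⨅ p ∈ A, MvPolynomial.vanishingIdeal k (p.submodule : Set (Fin 3 → k))

/-- The degree `t` part of `S / I`: the image of the forms of degree `t`. -/
def quotientDegree (I : Ideal (PolyRing k)) (t : ℕ) : Submodule k (PolyRing k ⧸ I) :=
  (MvPolynomial.homogeneousSubmodule (Fin 3) k t).map (Ideal.Quotient.mkₐ k I).toLinearMap

/-- `A` is generic: `dim_k (S / I_A)_t = min {#A, (t + 2) choose 2}` for every `t`. -/
def IsGeneric (A : Finset (Plane k)) : Prop :=
  ∀ t : ℕ, Module.finrank k (quotientDegree (pointsIdeal A) t) = min A.card ((t + 2).choose 2)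

/-- `A` is linearly general: no three distinct points of `A` are collinear. -/
def IsLinearlyGeneral (A : Finset (Plane k)) : Prop :=
  ∀ p ∈ A, ∀ q ∈ A, ∀ r ∈ A, p ≠ q → p ≠ r → q ≠ r →
    ¬ Projectivization.IsCollinear {p, q, r}

/-- `f` is a product of finitely many linear forms. -/
def IsProductOfLinearForms (f : PolyRing k) : Prop :=
  ∃ s : Multiset (PolyRing k), (∀ l ∈ s, l.IsHomogeneous 1) ∧ s.prod = f

/-- `I` is pl-generated: it is generated by products of linear forms. -/
def IsPLGenerated (I : Ideal (PolyRing k)) : Prop :=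
  ∃ G : Set (PolyRing k), (∀ f ∈ G, IsProductOfLinearForms f) ∧ I = Ideal.span G

/-- `l` is a nonzero linear form that vanishes at `p` and `q`; for `p ≠ q` this says that `l` is an
equation of the line joining `p` to `q`. -/
def IsLineEquation (l : PolyRing k) (p q : Plane k) : Prop :=
  l ≠ 0 ∧ l.IsHomogeneous 1 ∧
    (∀ v ∈ p.submodule, MvPolynomial.eval v l = 0) ∧
    ∀ v ∈ q.submodule, MvPolynomial.eval v l = 0

end PlanePoints

end

open MvPolynomial

/-! Since 6 = (4 choose 2), genericity in degree 2 says that no conic passes through `A`. Choose a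
linear form `l` vanishing at no point of `A`; it is a nonzerodivisor modulo the ideal. If four
cubics in the ideal are independent, their span meets `l * S_2` trivially, and 4 + 6 = 10 = dim S_3,
so together they fill S_3. Hence every form of degree at least 3 is `q + l * h` with `q` in the
ideal of the cubics, and descending on degree through `h` reaches degree 2, where the ideal vanishes
(`pointsIdeal_eq_span_of_linearIndependent`). Independence (`linearIndependent_cubics`) comes from
restricting a relation to lines through two of the points. -/

namespace PlanePoints

/-! ### Homogeneous polynomials and their values. -/

section Forms

variable {σ k : Type*} [Field k]

theorem eval_smul_of_isHomogeneous {f : MvPolynomial σ k} {n : ℕ} (hf : f.IsHomogeneous n)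
    (c : k) (v : σ → k) : eval (c • v) f = c ^ n * eval v f := by
  rw [eval_eq, eval_eq, Finset.mul_sum]
  refine Finset.sum_congr rfl fun d hd => ?_
  have h : ∑ i ∈ d.support, d i = n := by
    have := hf.degree_eq_sum_deg_support hd
    simpa [Finsupp.degree] using this.symm
  simp only [Pi.smul_apply, smul_eq_mul, mul_pow, Finset.prod_mul_distrib,
    Finset.prod_pow_eq_pow_sum, h]
  ring

theorem eval_add_of_isHomogeneous_one {l : MvPolynomial σ k} (hl : l.IsHomogeneous 1)
    (u v : σ → k) : eval (u + v) l = eval u l + eval v l := by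
  have h : l ∈ Submodule.span k (Set.range (X : σ → MvPolynomial σ k)) := by
    rw [← homogeneousSubmodule_one_eq_span_X]; exact hl
  induction h using Submodule.span_induction with
  | mem x hx => obtain ⟨i, rfl⟩ := hx; simp
  | zero => simp
  | add x y hx hy ihx ihy =>
    rw [← homogeneousSubmodule_one_eq_span_X] at hx hy
    rw [map_add, map_add, map_add, ihx hx, ihy hy]; ring
  | smul a x hx ih =>
    rw [← homogeneousSubmodule_one_eq_span_X] at hx
    rw [smul_eval, smul_eval, smul_eval, ih hx]; ring

theorem eval_smul_of_isHomogeneous_one {l : MvPolynomial σ k} (hl : l.IsHomogeneous 1)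
    (c : k) (v : σ → k) : eval (c • v) l = c * eval v l := by
  rw [eval_smul_of_isHomogeneous hl, pow_one]

/-- Over an infinite field, the homogeneous components of a polynomial that vanishes on the line
spanned by `v` vanish at `v`. -/
theorem eval_homogeneousComponent_eq_zero [Infinite k] {f : MvPolynomial σ k} {v : σ → k}
    (hf : ∀ c : k, eval (c • v) f = 0) (n : ℕ) : eval v (homogeneousComponent n f) = 0 := by
  -- `P` is `f (c • v)` as a polynomial in `c`; it vanishes at every `c` in an infinite field.
  let P : Polynomial k := ∑ i ∈ Finset.range (f.totalDegree + 1),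
    Polynomial.monomial i (eval v (homogeneousComponent i f))
  have hP : P = 0 := by
    refine Polynomial.funext fun c => ?_
    rw [Polynomial.eval_zero, ← hf c]
    conv_rhs => rw [← sum_homogeneousComponent f]
    rw [map_sum, Polynomial.eval_finsetSum]
    refine Finset.sum_congr rfl fun i _ => ?_
    rw [eval_smul_of_isHomogeneous (homogeneousComponent_isHomogeneous i f),
      Polynomial.eval_monomial, mul_comm]
  by_cases hn : n ≤ f.totalDegree
  · have := congrArg (fun q => Polynomial.coeff q n) hP
    simpa [P, Polynomial.finsetSum_coeff, Polynomial.coeff_monomial, Nat.lt_succ_iff, hn]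
      using this
  · rw [homogeneousComponent_eq_zero _ _ (not_le.mp hn), map_zero]

theorem finrank_homogeneousSubmodule (n : ℕ) :
    Module.finrank k (homogeneousSubmodule (Fin 3) k n) = (n + 2).choose 2 := by
  have hs : {d : Fin 3 →₀ ℕ | d.degree = n} =
      ((Finset.univ : Finset (Fin 3)).finsuppAntidiag n : Set (Fin 3 →₀ ℕ)) := by
    ext d
    simp [Finsupp.degree_eq_sum]
  rw [homogeneousSubmodule_eq_finsupp_supported, hs]
  refine (Module.finrank_eq_card_basis (basisRestrictSupport k _)).trans ?_
  rw [← Set.toFinset_card, Finset.toFinset_coe, Finset.card_finsuppAntidiag_nat_eq_choose,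
    Finset.card_univ, Fintype.card_fin, show 3 + n - 1 = n + 2 by omega,
    ← Nat.choose_symm_add]

instance finiteDimensional_homogeneousSubmodule (n : ℕ) :
    FiniteDimensional k (homogeneousSubmodule (Fin 3) k n) :=
  Module.Finite.iff_fg.mpr (homogeneousSubmodule_fg (Fin 3) k n)

/-- The linear form attached to a linear functional. -/
theorem exists_isHomogeneous_one_eval [Fintype σ] (φ : Module.Dual k (σ → k)) :
    ∃ l : MvPolynomial σ k, l.IsHomogeneous 1 ∧ ∀ v, eval v l = φ v := by
  classical
  refine ⟨∑ i, C (φ fun j => if i = j then 1 else 0) * X i,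
    IsHomogeneous.sum _ _ _ fun i _ => isHomogeneous_C_mul_X _ _, fun v => ?_⟩
  rw [LinearMap.pi_apply_eq_sum_univ φ v]
  simp [mul_comm]

end Forms

/-! ### The ideal of a set of points. -/

section Points

variable {k : Type*} [Field k]

theorem mem_pointsIdeal_iff {A : Finset (Plane k)} {f : PolyRing k} :
    f ∈ pointsIdeal A ↔ ∀ p ∈ A, ∀ c : k, eval (c • p.rep) f = 0 := by
  simp only [pointsIdeal, Ideal.mem_iInf, mem_vanishingIdeal_iff, Projectivization.submodule_eq,
    SetLike.mem_coe, Submodule.mem_span_singleton, forall_exists_index, forall_apply_eq_imp_iff,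
    aeval_eq_eval]

theorem mem_pointsIdeal_iff_of_isHomogeneous {A : Finset (Plane k)} {f : PolyRing k} {n : ℕ}
    (hf : f.IsHomogeneous n) : f ∈ pointsIdeal A ↔ ∀ p ∈ A, eval p.rep f = 0 := by
  rw [mem_pointsIdeal_iff]
  refine ⟨fun h p hp => by simpa using h p hp 1, fun h p hp c => ?_⟩
  rw [eval_smul_of_isHomogeneous hf, h p hp, mul_zero]

theorem homogeneousComponent_mem_pointsIdeal [Infinite k] {A : Finset (Plane k)} {f : PolyRing k}
    (hf : f ∈ pointsIdeal A) (n : ℕ) : homogeneousComponent n f ∈ pointsIdeal A := by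
  rw [mem_pointsIdeal_iff_of_isHomogeneous (homogeneousComponent_isHomogeneous n f)]
  exact fun p hp => eval_homogeneousComponent_eq_zero (mem_pointsIdeal_iff.mp hf p hp) n

/-- A linear form that vanishes at none of the points of `A` is a nonzerodivisor modulo
`pointsIdeal A`. -/
theorem mem_pointsIdeal_of_mul_mem {A : Finset (Plane k)} {l h : PolyRing k} {n : ℕ}
    (hl : ∀ p ∈ A, eval p.rep l ≠ 0) (hh : h.IsHomogeneous n) (hlh : l * h ∈ pointsIdeal A) :
    h ∈ pointsIdeal A := by
  rw [mem_pointsIdeal_iff_of_isHomogeneous hh]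
  intro p hp
  have := mem_pointsIdeal_iff.mp hlh p hp 1
  rw [one_smul, map_mul] at this
  exact (mul_eq_zero.mp this).resolve_left (hl p hp)

theorem exists_linearForm_eval_ne_zero [Infinite k] (A : Finset (Plane k)) :
    ∃ l : PolyRing k, l.IsHomogeneous 1 ∧ ∀ p ∈ A, eval p.rep l ≠ 0 := by
  obtain ⟨φ, hφ⟩ := Module.exists_dual_forall_apply_ne_zero (K := k)
    (fun p : A => (p : Plane k).rep) fun p => Projectivization.rep_nonzero _
  obtain ⟨l, hl, hlφ⟩ := exists_isHomogeneous_one_eval φ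
  exact ⟨l, hl, fun p hp => by rw [hlφ]; exact hφ ⟨p, hp⟩⟩

/-- Both S_2 and its image modulo the ideal have dimension 6, so the quotient map is injective on
S_2. -/
theorem eq_zero_of_mem_pointsIdeal_of_isHomogeneous_two {A : Finset (Plane k)}
    (hcard : A.card = 6) (hgeneric : IsGeneric A) {f : PolyRing k} (hf : f.IsHomogeneous 2)
    (hfA : f ∈ pointsIdeal A) : f = 0 := by
  let φ := (Ideal.Quotient.mkₐ k (pointsIdeal A)).toLinearMap.submoduleMap
    (homogeneousSubmodule (Fin 3) k 2)
  have hfin : Module.finrank k (homogeneousSubmodule (Fin 3) k 2) =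
      Module.finrank k ((homogeneousSubmodule (Fin 3) k 2).map
        (Ideal.Quotient.mkₐ k (pointsIdeal A)).toLinearMap) := by
    have := hgeneric 2
    rw [quotientDegree, hcard] at this
    rw [this, finrank_homogeneousSubmodule]
    rfl
  have hinj : Function.Injective φ :=
    (LinearMap.injective_iff_surjective_of_finrank_eq_finrank hfin).mpr
      (LinearMap.submoduleMap_surjective _ _)
  have h0 : φ ⟨f, hf⟩ = φ 0 := by
    rw [map_zero]
    exact Subtype.ext (Ideal.Quotient.eq_zero_iff_mem.mpr hfA)
  exact congrArg Subtype.val (hinj h0)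

theorem eq_zero_of_mem_pointsIdeal_of_isHomogeneous_le_two {A : Finset (Plane k)}
    (hcard : A.card = 6) (hgeneric : IsGeneric A) {f : PolyRing k} {n : ℕ} (hn : n ≤ 2)
    (hf : f.IsHomogeneous n) (hfA : f ∈ pointsIdeal A) : f = 0 := by
  have hX : ((X 0 : PolyRing k) ^ (2 - n)).IsHomogeneous (2 - n) := by
    simpa using (isHomogeneous_X k (0 : Fin 3)).pow (2 - n)
  have h := eq_zero_of_mem_pointsIdeal_of_isHomogeneous_two hcard hgeneric (f := X 0 ^ (2 - n) * f)
    (by simpa [Nat.sub_add_cancel hn] using hX.mul hf) (Ideal.mul_mem_left _ _ hfA)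
  exact (mul_eq_zero.mp h).resolve_left (pow_ne_zero _ (X_ne_zero _))

/-- Four linearly independent cubics through six generic points generate the ideal of the points. -/
theorem pointsIdeal_eq_span_of_linearIndependent [Infinite k] {A : Finset (Plane k)}
    (hcard : A.card = 6) (hgeneric : IsGeneric A) (Q : Fin 4 → PolyRing k)
    (hQ : ∀ i, (Q i).IsHomogeneous 3) (hQA : ∀ i, Q i ∈ pointsIdeal A)
    (hind : LinearIndependent k Q) : pointsIdeal A = Ideal.span (Set.range Q) := by
  obtain ⟨l, hl, hlA⟩ := exists_linearForm_eval_ne_zero A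
  have hle : Ideal.span (Set.range Q) ≤ pointsIdeal A := by
    rw [Ideal.span_le]
    rintro _ ⟨i, rfl⟩
    exact hQA i
  -- Source and target both have dimension 10, so surjectivity follows from injectivity.
  let φ : ((Fin 4 → k) × homogeneousSubmodule (Fin 3) k 2) →ₗ[k] homogeneousSubmodule (Fin 3) k 3 :=
    LinearMap.codRestrict _
      ((Fintype.linearCombination k Q).coprod
        ((LinearMap.mulLeft k l).comp (Submodule.subtype _))) (by
        rintro ⟨c, h⟩
        refine Submodule.add_mem _ ?_ ?_
        · change ∑ i, c i • Q i ∈ homogeneousSubmodule (Fin 3) k 3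
          exact Submodule.sum_mem _ fun i _ => Submodule.smul_mem _ _ (hQ i)
        · exact hl.mul h.2)
  have hφ (c h) : (φ (c, h) : PolyRing k) = ∑ i, c i • Q i + l * h := rfl
  have hinj : Function.Injective φ := by
    rw [injective_iff_map_eq_zero]
    rintro ⟨c, h⟩ hch
    have hsum : ∑ i, c i • Q i + l * h = 0 := by rw [← hφ, hch]; rfl
    have hlh : l * (h : PolyRing k) ∈ pointsIdeal A := by
      rw [eq_neg_of_add_eq_zero_right hsum, Ideal.neg_mem_iff]
      exact Ideal.sum_mem _ fun i _ => Submodule.smul_of_tower_mem _ _ (hQA i)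
    have hh := eq_zero_of_mem_pointsIdeal_of_isHomogeneous_two hcard hgeneric h.2
      (mem_pointsIdeal_of_mul_mem hlA h.2 hlh)
    rw [hh, mul_zero, add_zero] at hsum
    exact Prod.ext (funext (Fintype.linearIndependent_iff.mp hind c hsum)) (Subtype.ext hh)
  have hsurj : Function.Surjective φ := by
    refine (LinearMap.injective_iff_surjective_of_finrank_eq_finrank ?_).mp hinj
    rw [Module.finrank_prod, finrank_homogeneousSubmodule, finrank_homogeneousSubmodule,
      Module.finrank_fin_fun]
    rfl
  have hdecomp (n : ℕ) : ∀ f : PolyRing k, f.IsHomogeneous (n + 3) →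
      ∃ q ∈ Ideal.span (Set.range Q), ∃ h : PolyRing k, h.IsHomogeneous (n + 2) ∧
        f = q + l * h := by
    induction n with
    | zero =>
      intro f hf
      obtain ⟨⟨c, h⟩, hch⟩ := hsurj ⟨f, hf⟩
      refine ⟨∑ i, c i • Q i, Ideal.sum_mem _ fun i _ => Submodule.smul_of_tower_mem _ _
        (Ideal.subset_span ⟨i, rfl⟩), h, h.2, ?_⟩
      rw [← hφ, hch]
    | succ n ih =>
      intro f hf
      -- S_{n+4} = S_{n+3} * S_1, so the decomposition is multiplied by linear forms.
      have hf' : f ∈ homogeneousSubmodule (Fin 3) k (n + 3) * homogeneousSubmodule (Fin 3) k 1 := by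
        rw [← homogeneousSubmodule_one_pow (σ := Fin 3) (R := k) (n := n + 3), ← pow_succ,
          homogeneousSubmodule_one_pow]
        exact (show n + 1 + 3 = n + 3 + 1 by omega) ▸ hf
      refine Submodule.mul_induction_on hf' (fun g hg m hm => ?_) fun f g ihf ihg => ?_
      · obtain ⟨q, hq, h, hh, rfl⟩ := ih g hg
        refine ⟨q * m, Ideal.mul_mem_right _ _ hq, h * m, ?_, by ring⟩
        exact (show n + 2 + 1 = n + 1 + 2 by omega) ▸ hh.mul hm
      · obtain ⟨q, hq, h, hh, rfl⟩ := ihf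
        obtain ⟨q', hq', h', hh', rfl⟩ := ihg
        exact ⟨q + q', Ideal.add_mem _ hq hq', h + h', hh.add hh', by ring⟩
  have hform (n : ℕ) : ∀ f : PolyRing k, f.IsHomogeneous (n + 2) → f ∈ pointsIdeal A →
      f ∈ Ideal.span (Set.range Q) := by
    induction n with
    | zero =>
      intro f hf hfA
      rw [eq_zero_of_mem_pointsIdeal_of_isHomogeneous_two hcard hgeneric hf hfA]
      exact Ideal.zero_mem _
    | succ n ih =>
      intro f hf hfA
      obtain ⟨q, hq, h, hh, rfl⟩ := hdecomp n f hf
      -- `q` lies in the ideal, hence so does `l * h`, and `l` can be cancelled.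
      have hlh : l * h ∈ pointsIdeal A := (Ideal.add_mem_iff_right _ (hle hq)).mp hfA
      exact Ideal.add_mem _ hq
        (Ideal.mul_mem_left _ _ (ih h hh (mem_pointsIdeal_of_mul_mem hlA hh hlh)))
  refine le_antisymm (fun f hf => ?_) hle
  rw [← sum_homogeneousComponent f]
  refine Ideal.sum_mem _ fun n _ => ?_
  have hn := homogeneousComponent_isHomogeneous n f
  have hnA := homogeneousComponent_mem_pointsIdeal hf n
  rcases le_total n 2 with h | h
  · rw [eq_zero_of_mem_pointsIdeal_of_isHomogeneous_le_two hcard hgeneric h hn hnA]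
    exact Ideal.zero_mem _
  · obtain ⟨m, rfl⟩ := Nat.exists_eq_add_of_le' h
    exact hform m _ hn hnA

/-! ### Collinearity and equations of lines. -/

theorem linearIndependent_rep_of_not_isCollinear {p q r : Plane k}
    (h : ¬ Projectivization.IsCollinear {p, q, r}) :
    LinearIndependent k ![p.rep, q.rep, r.rep] := by
  by_contra hdep
  let M := Submodule.span k (Set.range ![p.rep, q.rep, r.rep])
  have hfin : Module.finrank k M ≤ 2 := by
    change Module.finrank k (Submodule.span k (Set.range ![p.rep, q.rep, r.rep])) ≤ 2
    rw [linearIndependent_iff_card_le_finrank_span, Fintype.card_fin, Set.finrank] at hdep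
    omega
  have hsub : Projectivization.Subspace.submodule M.projectivization = M :=
    OrderIso.apply_symm_apply _ M
  have hmem (x : Plane k) (hx : x.rep ∈ M) : x ∈ M.projectivization := by
    rwa [Submodule.mem_projectivization_iff_submodule_le, Projectivization.submodule_eq,
      Submodule.span_singleton_le_iff_mem]
  refine h ⟨M.projectivization, inferInstance, hsub.symm ▸ hfin, ?_⟩
  rintro x (rfl | rfl | rfl)
  · exact hmem _ (Submodule.subset_span ⟨0, rfl⟩)
  · exact hmem _ (Submodule.subset_span ⟨1, rfl⟩)
  · exact hmem _ (Submodule.subset_span ⟨2, rfl⟩)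

theorem exists_isLineEquation (p q : Plane k) : ∃ l : PolyRing k, IsLineEquation l p q := by
  have hlt : Submodule.span k (Set.range ![p.rep, q.rep]) < ⊤ := by
    refine lt_top_iff_ne_top.mpr fun h => ?_
    have := finrank_range_le_card (R := k) ![p.rep, q.rep]
    rw [Set.finrank, h] at this
    simp at this
  obtain ⟨φ, hφ, hle⟩ := Submodule.exists_le_ker_of_lt_top _ hlt
  obtain ⟨l, hl, hlφ⟩ := exists_isHomogeneous_one_eval φ
  refine ⟨l, ?_, hl, ?_, ?_⟩
  · rintro rfl
    exact hφ (LinearMap.ext fun v => by simpa using (hlφ v).symm)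
  all_goals
    intro v hv
    rw [Projectivization.submodule_eq, Submodule.mem_span_singleton] at hv
    obtain ⟨c, rfl⟩ := hv
    rw [hlφ, map_smul, smul_eq_zero]
    right
  · exact hle (Submodule.subset_span ⟨0, rfl⟩)
  · exact hle (Submodule.subset_span ⟨1, rfl⟩)

theorem IsLineEquation.eval_left {l : PolyRing k} {p q : Plane k} (h : IsLineEquation l p q) :
    eval p.rep l = 0 :=
  h.2.2.1 _ (by rw [Projectivization.submodule_eq]; exact Submodule.mem_span_singleton_self _)

theorem IsLineEquation.eval_right {l : PolyRing k} {p q : Plane k} (h : IsLineEquation l p q) :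
    eval q.rep l = 0 :=
  h.2.2.2 _ (by rw [Projectivization.submodule_eq]; exact Submodule.mem_span_singleton_self _)

theorem exists_eq_combination_of_linearIndependent {u v w : Fin 3 → k}
    (h : LinearIndependent k ![u, v, w]) (x : Fin 3 → k) :
    ∃ a b c : k, x = a • u + b • v + c • w := by
  have hx : x ∈ Submodule.span k (Set.range ![u, v, w]) := by
    rw [h.span_eq_top_of_card_eq_finrank (by simp)]; trivial
  obtain ⟨c, rfl⟩ := (Submodule.mem_span_range_iff_exists_fun k).mp hx
  exact ⟨c 0, c 1, c 2, by simp [Fin.sum_univ_three]⟩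

/-- The equation of a line does not vanish at a point off the line. -/
theorem IsLineEquation.eval_ne_zero [Infinite k] {l : PolyRing k} {p q r : Plane k}
    (h : IsLineEquation l p q) (hind : LinearIndependent k ![p.rep, q.rep, r.rep]) :
    eval r.rep l ≠ 0 := by
  intro hr
  refine h.1 (MvPolynomial.funext fun x => ?_)
  obtain ⟨a, b, c, rfl⟩ := exists_eq_combination_of_linearIndependent hind x
  simp only [eval_add_of_isHomogeneous_one h.2.1, eval_smul_of_isHomogeneous_one h.2.1,
    h.eval_left, h.eval_right, hr, mul_zero, add_zero, map_zero]

/-- The lines `a b` and `b c` do not meet on the line `u v`. -/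
theorem IsLineEquation.mul_eval_ne_mul_eval {l m : PolyRing k} {a b c u v : Plane k}
    (hl : IsLineEquation l a b) (hm : IsLineEquation m b c)
    (habc : LinearIndependent k ![a.rep, b.rep, c.rep])
    (huvb : LinearIndependent k ![u.rep, v.rep, b.rep])
    (hlc : eval c.rep l ≠ 0) (hma : eval a.rep m ≠ 0) (hlv : eval v.rep l ≠ 0) :
    eval u.rep l * eval v.rep m ≠ eval v.rep l * eval u.rep m := by
  intro heq
  -- This combination is the point of the line `u v` where `l` vanishes. If `m` vanished there too,
  -- it would be a multiple of `b`, which is off that line.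
  obtain ⟨x, y, z, hxyz⟩ := exists_eq_combination_of_linearIndependent habc
    (eval v.rep l • u.rep + (-eval u.rep l) • v.rep)
  have hz := congrArg (fun w => eval w l) hxyz
  have hx := congrArg (fun w => eval w m) hxyz
  simp only [eval_add_of_isHomogeneous_one hl.2.1, eval_smul_of_isHomogeneous_one hl.2.1,
    hl.eval_left, hl.eval_right] at hz
  simp only [eval_add_of_isHomogeneous_one hm.2.1, eval_smul_of_isHomogeneous_one hm.2.1,
    hm.eval_left, hm.eval_right] at hx
  have hz0 : z = 0 := (mul_eq_zero.mp (by linear_combination -hz)).resolve_right hlc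
  have hx0 : x = 0 := (mul_eq_zero.mp (by linear_combination -hx - heq)).resolve_right hma
  rw [hz0, hx0, zero_smul, zero_smul, zero_add, add_zero] at hxyz
  have := Fintype.linearIndependent_iff.mp huvb ![eval v.rep l, -eval u.rep l, -y]
    (by simpa [Fin.sum_univ_three, sub_eq_add_neg] using sub_eq_zero.mpr hxyz) 0
  exact hlv this

end Points

/-! ### The four cubics through six points. -/

section SixPoints

variable {k : Type*} [Field k] [Infinite k] {p : Fin 6 → Plane k}
  {L : Fin 6 → Fin 6 → PolyRing k}

/-- On the line through `p 0` and `p 1` the first two cubics vanish, and the other two become, up to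
nonzero constants and the common factor `L 1 5`, the restrictions of `L 2 3` and `L 3 4`. These are
independent since the two lines meet at `p 3`, off that line. So `g 2 = g 3 = 0`, and dividing by `L
0 1` leaves a relation between two conics. -/
theorem linearIndependent_cubics
    (hp : ∀ a b c, a ≠ b → a ≠ c → b ≠ c →
      LinearIndependent k ![(p a).rep, (p b).rep, (p c).rep])
    (hL : ∀ i j, i < j → IsLineEquation (L i j) (p i) (p j)) :
    LinearIndependent k ![L 0 1 * L 2 3 * L 4 5, L 0 1 * L 2 4 * L 3 5,
      L 0 4 * L 1 5 * L 2 3, L 0 2 * L 1 5 * L 3 4] := by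
  have hne (i j : Fin 6) (hij : i < j) (r : Fin 6) (hi : i ≠ r) (hj : j ≠ r) :
      eval (p r).rep (L i j) ≠ 0 := (hL i j hij).eval_ne_zero (hp i j r hij.ne hi hj)
  rw [Fintype.linearIndependent_iff]
  intro g hg
  simp only [Fin.sum_univ_four, Matrix.cons_val] at hg
  have hline (s : k) (hs : s ≠ 0) :
      (g 2 * eval (p 1).rep (L 0 4) * eval (p 0).rep (L 2 3) +
        g 3 * eval (p 1).rep (L 0 2) * eval (p 0).rep (L 3 4)) * s +
      (g 2 * eval (p 1).rep (L 0 4) * eval (p 1).rep (L 2 3) +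
        g 3 * eval (p 1).rep (L 0 2) * eval (p 1).rep (L 3 4)) = 0 := by
    have h := congrArg (eval (s • (p 0).rep + (p 1).rep)) hg
    simp only [map_add, map_mul, smul_eval, map_zero,
      eval_add_of_isHomogeneous_one (hL _ _ (show (0 : Fin 6) < 1 by decide)).2.1,
      eval_add_of_isHomogeneous_one (hL _ _ (show (2 : Fin 6) < 3 by decide)).2.1,
      eval_add_of_isHomogeneous_one (hL _ _ (show (0 : Fin 6) < 4 by decide)).2.1,
      eval_add_of_isHomogeneous_one (hL _ _ (show (1 : Fin 6) < 5 by decide)).2.1,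
      eval_add_of_isHomogeneous_one (hL _ _ (show (0 : Fin 6) < 2 by decide)).2.1,
      eval_add_of_isHomogeneous_one (hL _ _ (show (3 : Fin 6) < 4 by decide)).2.1,
      eval_smul_of_isHomogeneous_one (hL _ _ (show (0 : Fin 6) < 1 by decide)).2.1,
      eval_smul_of_isHomogeneous_one (hL _ _ (show (2 : Fin 6) < 3 by decide)).2.1,
      eval_smul_of_isHomogeneous_one (hL _ _ (show (0 : Fin 6) < 4 by decide)).2.1,
      eval_smul_of_isHomogeneous_one (hL _ _ (show (1 : Fin 6) < 5 by decide)).2.1,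
      eval_smul_of_isHomogeneous_one (hL _ _ (show (0 : Fin 6) < 2 by decide)).2.1,
      eval_smul_of_isHomogeneous_one (hL _ _ (show (3 : Fin 6) < 4 by decide)).2.1,
      (hL 0 1 (by decide)).eval_left, (hL 0 1 (by decide)).eval_right,
      (hL 0 4 (by decide)).eval_left, (hL 1 5 (by decide)).eval_left,
      (hL 0 2 (by decide)).eval_left] at h
    have h0 : s * eval (p 0).rep (L 1 5) ≠ 0 :=
      mul_ne_zero hs (hne 1 5 (by decide) 0 (by decide) (by decide))
    refine (mul_eq_zero.mp ?_).resolve_left h0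
    linear_combination h
  classical
  -- The expression in `hline` is affine in the parameter; two distinct nonzero values, 1 and `s`,
  -- kill both coefficients.
  obtain ⟨s, hs⟩ := Infinite.exists_notMem_finset ({0, 1} : Finset k)
  simp only [Finset.mem_insert, Finset.mem_singleton, not_or] at hs
  have h1 := hline 1 one_ne_zero
  have hs1 := hline s hs.1
  have hu := (mul_eq_zero.mp (show
      (s - 1) * (g 2 * eval (p 1).rep (L 0 4) * eval (p 0).rep (L 2 3) +
        g 3 * eval (p 1).rep (L 0 2) * eval (p 0).rep (L 3 4)) = 0 by
    linear_combination hs1 - h1)).resolve_left (sub_ne_zero.mpr hs.2)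
  have hv : g 2 * eval (p 1).rep (L 0 4) * eval (p 1).rep (L 2 3) +
        g 3 * eval (p 1).rep (L 0 2) * eval (p 1).rep (L 3 4) = 0 := by
    linear_combination h1 - hu
  have hdet := (hL 2 3 (by decide)).mul_eval_ne_mul_eval (hL 3 4 (by decide))
    (u := p 0) (v := p 1) (hp 2 3 4 (by decide) (by decide) (by decide))
    (hp 0 1 3 (by decide) (by decide) (by decide))
    (hne 2 3 (by decide) 4 (by decide) (by decide))
    (hne 3 4 (by decide) 2 (by decide) (by decide))
    (hne 2 3 (by decide) 1 (by decide) (by decide))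
  have hg2 : g 2 = 0 := by
    have : g 2 * eval (p 1).rep (L 0 4) = 0 :=
      (mul_eq_zero.mp (by
        linear_combination
          eval (p 1).rep (L 3 4) * hu - eval (p 0).rep (L 3 4) * hv)).resolve_right
        (sub_ne_zero.mpr hdet)
    exact (mul_eq_zero.mp this).resolve_right (hne 0 4 (by decide) 1 (by decide) (by decide))
  have hg3 : g 3 = 0 := by
    rw [hg2, zero_mul, zero_mul, zero_add] at hu
    exact (mul_eq_zero.mp ((mul_eq_zero.mp hu).resolve_right
      (hne 3 4 (by decide) 0 (by decide) (by decide)))).resolve_right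
      (hne 0 2 (by decide) 1 (by decide) (by decide))
  have hquad : g 0 • (L 2 3 * L 4 5) + g 1 • (L 2 4 * L 3 5) = 0 := by
    refine (mul_eq_zero.mp ?_).resolve_left (hL 0 1 (by decide)).1
    rw [← hg, hg2, hg3]
    simp only [smul_eq_C_mul, C_0]
    ring
  have hg0 : g 0 = 0 := by
    -- A point of the line `L 2 4` other than `p 2` and `p 4`: the second conic vanishes there, the
    -- first does not.
    have h := congrArg (eval ((p 2).rep + (p 4).rep)) hquad
    simp only [map_add, map_mul, smul_eval, map_zero,
      eval_add_of_isHomogeneous_one (hL _ _ (show (2 : Fin 6) < 3 by decide)).2.1,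
      eval_add_of_isHomogeneous_one (hL _ _ (show (4 : Fin 6) < 5 by decide)).2.1,
      eval_add_of_isHomogeneous_one (hL _ _ (show (2 : Fin 6) < 4 by decide)).2.1,
      (hL 2 3 (by decide)).eval_left, (hL 4 5 (by decide)).eval_left,
      (hL 2 4 (by decide)).eval_left, (hL 2 4 (by decide)).eval_right] at h
    refine (mul_eq_zero.mp ?_).resolve_right
      (mul_ne_zero (hne 2 3 (by decide) 4 (by decide) (by decide))
        (hne 4 5 (by decide) 2 (by decide) (by decide)))
    linear_combination h
  have hg1 : g 1 = 0 := by
    rw [hg0, zero_smul, zero_add, smul_eq_zero] at hquad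
    exact hquad.resolve_right (mul_ne_zero (hL 2 4 (by decide)).1 (hL 3 5 (by decide)).1)
  intro i
  fin_cases i
  exacts [hg0, hg1, hg2, hg3]

theorem pointsIdeal_eq_span_cubics {A : Finset (Plane k)} (hcard : A.card = 6)
    (hgeneric : IsGeneric A) (hlinear : IsLinearlyGeneral A) (hp : Function.Injective p)
    (hpA : Set.range p = (A : Set _))
    (hL : ∀ i j, i < j → IsLineEquation (L i j) (p i) (p j)) :
    pointsIdeal A = Ideal.span {L 0 1 * L 2 3 * L 4 5, L 0 1 * L 2 4 * L 3 5,
      L 0 4 * L 1 5 * L 2 3, L 0 2 * L 1 5 * L 3 4} := by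
  have hmem (i : Fin 6) : p i ∈ A := by
    rw [← Finset.mem_coe, ← hpA]; exact ⟨i, rfl⟩
  have hind (a b c : Fin 6) (hab : a ≠ b) (hac : a ≠ c) (hbc : b ≠ c) :=
    linearIndependent_rep_of_not_isCollinear (hlinear _ (hmem a) _ (hmem b) _ (hmem c)
      (hp.ne hab) (hp.ne hac) (hp.ne hbc))
  have hhom {a b c d e f : Fin 6} (hab : a < b) (hcd : c < d) (hef : e < f) :
      (L a b * L c d * L e f).IsHomogeneous 3 :=
    ((hL a b hab).2.1.mul (hL c d hcd).2.1).mul (hL e f hef).2.1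
  have hvan {a b c d e f : Fin 6} (hab : a < b) (hcd : c < d) (hef : e < f)
      (hall : ∀ i, i = a ∨ i = b ∨ i = c ∨ i = d ∨ i = e ∨ i = f) :
      L a b * L c d * L e f ∈ pointsIdeal A := by
    rw [mem_pointsIdeal_iff_of_isHomogeneous (hhom hab hcd hef)]
    intro q hq
    rw [← Finset.mem_coe, ← hpA] at hq
    obtain ⟨i, rfl⟩ := hq
    rw [map_mul, map_mul]
    rcases hall i with rfl | rfl | rfl | rfl | rfl | rfl <;>
      simp [(hL _ _ hab).eval_left, (hL _ _ hab).eval_right, (hL _ _ hcd).eval_left,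
        (hL _ _ hcd).eval_right, (hL _ _ hef).eval_left, (hL _ _ hef).eval_right]
  rw [pointsIdeal_eq_span_of_linearIndependent hcard hgeneric _ ?_ ?_
    (linearIndependent_cubics hind hL)]
  · congr 1
    simp only [Matrix.range_cons, Matrix.range_empty, Set.union_empty, Set.singleton_union]
  · intro i
    fin_cases i
    all_goals exact hhom (by decide) (by decide) (by decide)
  · intro i
    fin_cases i
    -- In each cubic the indices of the three lines cover all six points.
    all_goals exact hvan (by decide) (by decide) (by decide) (by decide)

end SixPoints

end PlanePoints

/-- The points are labelled `p 0, …, p 5` in an arbitrary way, and `L i j` is any equation of the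
line joining `p i` to `p j`. -/
theorem mainTheorem6 {k : Type*} [Field k] [Infinite k]
    (A : Finset (PlanePoints.Plane k)) (hcard : A.card = 6)
    (hgeneric : PlanePoints.IsGeneric A) (hlinear : PlanePoints.IsLinearlyGeneral A) :
    (∀ p : Fin 6 → PlanePoints.Plane k, Function.Injective p → Set.range p = (A : Set _) →
      ∀ L : Fin 6 → Fin 6 → PlanePoints.PolyRing k,
        (∀ i j, i < j → PlanePoints.IsLineEquation (L i j) (p i) (p j)) →
        PlanePoints.pointsIdeal A = Ideal.span
          {L 0 1 * L 2 3 * L 4 5,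
           L 0 1 * L 2 4 * L 3 5,
           L 0 4 * L 1 5 * L 2 3,
           L 0 2 * L 1 5 * L 3 4}) ∧
    PlanePoints.IsPLGenerated (PlanePoints.pointsIdeal A) := by
  have hmain := fun (p : Fin 6 → PlanePoints.Plane k) hp hpA L hL =>
    PlanePoints.pointsIdeal_eq_span_cubics (p := p) (L := L) hcard hgeneric hlinear hp hpA hL
  refine ⟨hmain, ?_⟩
  let e := (A.equivFinOfCardEq hcard).symm
  choose L hL using fun i j : Fin 6 =>
    PlanePoints.exists_isLineEquation (e i : PlanePoints.Plane k) (e j)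
  refine ⟨_, ?_, hmain (fun i => e i) (Subtype.val_injective.comp e.injective) ?_ L
    fun i j _ => hL i j⟩
  · have hprod (a b c d e f : Fin 6) :
        PlanePoints.IsProductOfLinearForms (L a b * L c d * L e f) := by
      refine ⟨{L a b, L c d, L e f}, ?_, by simp [mul_assoc]⟩
      simp only [Multiset.insert_eq_cons, Multiset.mem_cons, Multiset.mem_singleton]
      rintro l (rfl | rfl | rfl)
      exacts [(hL _ _).2.1, (hL _ _).2.1, (hL _ _).2.1]
    simp only [Set.mem_insert_iff, Set.mem_singleton_iff]
    rintro f (rfl | rfl | rfl | rfl) <;> exact hprod _ _ _ _ _ _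
  · ext q
    refine ⟨?_, fun hq => ⟨e.symm ⟨q, hq⟩, by simp⟩⟩
    rintro ⟨i, rfl⟩
    exact (e i).2
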